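/- Let $m\ge 2$ be an integer and let $V_m=\{v_0<v_1<\dots<v_{m-1}\}$ be a chain of $m$ truth values with the Gödel implication $v_p\Rightarrow v_q=v_{m-1}$ if $p\le q$ and $v_p\Rightarrow v_q=v_q$ if $p>q$. For $n\ge 1$ let $g_n^{(j)}$ be the number of pairs $(B,\nu)$, where $B$ is a full bracketing of $p_1\Rightarrow p_2\Rightarrow\dots\Rightarrow p_n$ and $\nu:\{p_1,\dots,p_n\}\to V_m$ is a valuation, such that $B$ takes the value $v_j$ under $\nu$; and let $g_n=\sum_{j=0}^{m-1}g_n^{(j)}$. Put $r=\frac1{4m}$, $$\Psi_r(v)=\frac{1+v-\sqrt{(1-v)^2+4r}}{2}\quad(v\in\mathbb R),\qquad w_0=\tfrac12,\qquad w_{k+1}=\Psi_r(w_k)\quad(k\ge 0).$$ Then $\Psi_r$ is differentiable on $\mathbb R$, the limit $p_\top(m)=\lim_{n\to\infty} g_n^{(m-1)}/g_n$ exists, and $$p_\top(m)=\prod_{k=0}^{m-2}\partial_v\Psi_r(w_k)=\prod_{k=0}^{m-2}\frac12\left(1+\frac{1-w_k}{\sqrt{(1-w_k)^2+\frac1m}}\right),$$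 where $\partial_v\Psi_r$ is the derivative of $v\mapsto\Psi_r(v)$. Moreover, as $n\to\infty$, $$g_n^{(m-1)}\sim\frac{p_\top(m)}{4}\cdot\frac{(4m)^n}{\sqrt{\pi}\,n^{3/2}}.$$ -/

import Mathlib

open Filter Topology Asymptotics

namespace Godel

/-- The Gödel chain `v_0 < v_1 < ⋯ < v_{m-1}` is modelled by `Fin m`, with `v_j` being `j`.
Gödel implication: `v_p ⇒ v_q` is the top value `v_{m-1}` if `p ≤ q`, and `v_q` if `p > q`. -/
def imp {m : ℕ} (p q : Fin m) : Fin m :=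
  if p ≤ q then ⟨m - 1, Nat.sub_lt (Nat.zero_lt_of_lt p.isLt) Nat.one_pos⟩ else q

/-- Full bracketings of `p_1 ⇒ p_2 ⇒ ⋯ ⇒ p_n`: binary trees with `n` leaves, the leaves
carrying the variables `p_1, …, p_n` from left to right. (There are none for `n = 0`.) -/
def bracketings : ℕ → Finset (BinaryTree Unit)
  | 0 => ∅
  | n + 1 => BinaryTree.treesOfNumNodesEq n

theorem mem_bracketings {n : ℕ} {t : BinaryTree Unit} :
    t ∈ bracketings n ↔ t.numLeaves = n := by
  rw [BinaryTree.numLeaves_eq_numNodes_succ]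
  cases n <;> simp [bracketings]

/-- The value of a bracketing under a valuation `ν` of its variables, the variables being
numbered from left to right. At an implication, the left part uses the first variables and
the right part the remaining ones. -/
def eval {m : ℕ} : (t : BinaryTree Unit) → (Fin t.numLeaves → Fin m) → Fin m
  | .nil, ν => ν (0 : Fin 1)
  | .node _ a b, ν =>
      imp (eval a fun i => ν (Fin.castAdd b.numLeaves i))
        (eval b fun i => ν (Fin.natAdd a.numLeaves i))

/-- `g_n^{(j)}`: the number of occurrences of `v_j` in the output columns of the truth tables
of all bracketings on `n` variables, over all valuations. -/
def count (m n : ℕ) (j : Fin m) : ℕ :=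
  ∑ t ∈ bracketings n,
    (Finset.univ.filter fun ν : Fin t.numLeaves → Fin m => eval t ν = j).card

/-- `g_n`: the total number of truth-table entries. -/
def total (m n : ℕ) : ℕ :=
  ∑ j : Fin m, count m n j

/-- `Ψ_x(v)`. -/
noncomputable def Psi (x v : ℝ) : ℝ :=
  (1 + v - Real.sqrt ((1 - v) ^ 2 + 4 * x)) / 2

/-- The critical iterates for parameter `r`: `w_0 = 1/2` and `w_{k+1} = Ψ_r(w_k)`. -/
noncomputable def critIter (r : ℝ) : ℕ → ℝ
  | 0 => 1 / 2
  | k + 1 => Psi r (critIter r k)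

end Godel

/-! ### Truth-table counts and their convolution recurrence -/

namespace Godel

open Finset.HasAntidiagonal (antidiagonal)

/-! Count by thresholds. For `j` below the top, an implication takes value `v_j` exactly when its
right side is `v_j` and its left side exceeds `v_j`. If `u`, `v` are the counts of values of index
at least `k` and at least `k + 1`, scaled by `(4m)^(-n)`, this reads `u - v = r·[n = 1] + v * (u -
v)`, with `*` the convolution (`upperWeight_recurrence`). At level `0` the sequence is the Catalan
weights `a n = C_{n-1} / 4^n`, of sum `1/2`.

Summing turns the recurrence into a quadratic, so the sums `U`, `V` satisfy `V = Ψ_r(U)` and are the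
critical iterates (`hasSum_step`). If `u n / a n → l`, then `v n / a n → l · Ψ_r'(U)`
(`tendsto_step`). This is proved without complex analysis: a convolution is governed by its two
ends, its middle being negligible against `a n`, and the remaining error contracts by a factor
`1/2`. Iterating from the bottom to the top threshold gives the product; Stirling's formula gives
the growth of the total. -/

/-- The number of pairs (bracketing on `n` variables, valuation) whose value has index at
least `k`. -/
def upperCount (m k n : ℕ) : ℕ :=
  ∑ t ∈ bracketings n,
    (Finset.univ.filter fun ν : Fin t.numLeaves → Fin m => k ≤ (eval t ν : ℕ)).card

theorem sum_bracketings {M : Type*} [AddCommMonoid M] (F : BinaryTree Unit → M) (n : ℕ) :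
    ∑ t ∈ bracketings n, F t = (if n = 1 then F .nil else 0) +
      ∑ x ∈ antidiagonal n, ∑ a ∈ bracketings x.1, ∑ b ∈ bracketings x.2,
        F (.node () a b) := by
  match n with
  | 0 => simp [bracketings]
  | 1 => simp [bracketings, Finset.Nat.antidiagonal_succ]
  | n + 2 =>
    rw [Finset.Nat.sum_antidiagonal_succ, Finset.Nat.sum_antidiagonal_succ']
    simp only [bracketings, Finset.sum_empty, Finset.sum_const_zero, zero_add,
      BinaryTree.treesOfNumNodesEq_succ]
    rw [Finset.sum_biUnion]
    · simp only [Finset.sum_map, Finset.sum_product]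
      rw [if_neg (by omega), zero_add]
      rfl
    · simp_rw [Set.PairwiseDisjoint, Set.Pairwise, Finset.disjoint_left]
      aesop

/-- Below the top, `j` can only come from the branch that returns `q`, so `p > q = j`. -/
theorem imp_eq_iff {m : ℕ} (p q j : Fin m) (hj : (j : ℕ) + 1 < m) :
    imp p q = j ↔ (j : ℕ) + 1 ≤ p ∧ q = j := by
  unfold imp
  split_ifs with h
  · constructor
    · intro e
      have := congrArg Fin.val e
      simp only at this
      omega
    · rintro ⟨h1, rfl⟩
      have : (p : ℕ) ≤ q := h
      omega
  · constructor
    · rintro rfl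
      have : ¬ (p : ℕ) ≤ q := h
      exact ⟨by omega, rfl⟩
    · exact fun h => h.2

theorem card_eval_node {m : ℕ} (a b : BinaryTree Unit) (j : Fin m) (hj : (j : ℕ) + 1 < m) :
    (Finset.univ.filter fun ν : Fin (BinaryTree.node () a b).numLeaves → Fin m =>
        eval (.node () a b) ν = j).card =
      (Finset.univ.filter fun ν : Fin a.numLeaves → Fin m => (j : ℕ) + 1 ≤ (eval a ν : ℕ)).card *
      (Finset.univ.filter fun ν : Fin b.numLeaves → Fin m => eval b ν = j).card := by
  rw [← Finset.card_product]
  symm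
  refine Finset.card_equiv (Fin.appendEquiv a.numLeaves b.numLeaves) ?_
  rintro ⟨x, y⟩
  have h : eval (.node () a b) (Fin.append x y) = j ↔
      (j : ℕ) + 1 ≤ (eval a x : ℕ) ∧ eval b y = j := by
    simp only [eval, imp_eq_iff _ _ j hj, Fin.append_left, Fin.append_right]
  refine Iff.trans ?_ Finset.mem_filter.symm
  rw [Finset.mem_product, Finset.mem_filter, Finset.mem_filter]
  simp only [Finset.mem_univ, true_and]
  exact h.symm

theorem count_recurrence (m n : ℕ) (j : Fin m) (hj : (j : ℕ) + 1 < m) :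
    count m n j = (if n = 1 then 1 else 0) +
      ∑ x ∈ antidiagonal n, upperCount m (j + 1) x.1 * count m x.2 j := by
  unfold count
  rw [sum_bracketings]
  congr 1
  · congr 1
    rw [Finset.card_eq_one]
    refine ⟨fun _ => j, ?_⟩
    ext ν
    rw [Finset.mem_filter, Finset.mem_singleton]
    constructor
    · rintro ⟨-, h⟩
      funext i
      rw [← h]
      congr 1
      exact Subsingleton.elim (α := Fin 1) _ _
    · rintro rfl
      exact ⟨Finset.mem_univ _, rfl⟩
  · refine Finset.sum_congr rfl fun x _ => ?_
    rw [upperCount, Finset.sum_mul_sum]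
    exact Finset.sum_congr rfl fun a _ => Finset.sum_congr rfl fun b _ => card_eval_node a b j hj

theorem upperCount_eq_add (m n : ℕ) (j : Fin m) :
    upperCount m j n = upperCount m (j + 1) n + count m n j := by
  unfold upperCount count
  rw [← Finset.sum_add_distrib]
  refine Finset.sum_congr rfl fun t _ => ?_
  rw [← Finset.card_union_of_disjoint]
  · congr 1
    ext ν
    simp only [Finset.mem_filter, Finset.mem_univ, true_and, Finset.mem_union, Fin.ext_iff]
    omega
  · rw [Finset.disjoint_filter]
    intro ν _ h e
    rw [e] at h
    omega

theorem upperCount_last (m n : ℕ) (hm : m - 1 < m) :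
    upperCount m (m - 1) n = count m n ⟨m - 1, hm⟩ := by
  unfold upperCount count
  refine Finset.sum_congr rfl fun t _ => ?_
  congr 1
  ext ν
  simp only [Finset.mem_filter, Finset.mem_univ, true_and, Fin.ext_iff]
  have := (eval t ν).isLt
  omega

theorem total_eq_upperCount_zero (m n : ℕ) : total m n = upperCount m 0 n := by
  unfold total upperCount count
  rw [Finset.sum_comm]
  refine Finset.sum_congr rfl fun t _ => ?_
  simp [Finset.card_eq_sum_card_fiberwise (f := eval t) (s := Finset.univ) (t := Finset.univ)
    (fun _ _ => Finset.mem_coe.2 (Finset.mem_univ _))]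

theorem upperCount_zero_zero (m : ℕ) : upperCount m 0 0 = 0 := by
  simp [upperCount, bracketings]

theorem upperCount_zero_succ (m n : ℕ) : upperCount m 0 (n + 1) = catalan n * m ^ (n + 1) := by
  have h : ∀ t ∈ bracketings (n + 1), (Finset.univ.filter
      fun ν : Fin t.numLeaves → Fin m => 0 ≤ (eval t ν : ℕ)).card = m ^ (n + 1) := by
    intro t ht
    rw [mem_bracketings] at ht
    simp [ht]
  rw [upperCount, Finset.sum_congr rfl h, Finset.sum_const, smul_eq_mul, bracketings,
    BinaryTree.treesOfNumNodesEq_card_eq_catalan]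

/-! ### Catalan weights: sum and asymptotics -/

/-- The Catalan weights `C_{n-1} / 4^n`, with value `0` at `n = 0`. -/
noncomputable def catalanWeight : ℕ → ℝ
  | 0 => 0
  | n + 1 => catalan n / 4 ^ (n + 1)

theorem catalan_pos (n : ℕ) : 0 < catalan n := by
  have h := succ_mul_catalan_eq_centralBinom n
  have := Nat.centralBinom_pos n
  rw [← h] at this
  exact Nat.pos_of_mul_pos_left this

theorem catalanWeight_pos {n : ℕ} (hn : n ≠ 0) : 0 < catalanWeight n := by
  obtain ⟨n, rfl⟩ := Nat.exists_eq_succ_of_ne_zero hn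
  have := catalan_pos n
  simp only [catalanWeight]
  positivity

theorem catalanWeight_nonneg (n : ℕ) : 0 ≤ catalanWeight n := by
  rcases eq_or_ne n 0 with rfl | hn
  · simp [catalanWeight]
  · exact (catalanWeight_pos hn).le

theorem catalanWeight_eq_add_conv (n : ℕ) :
    catalanWeight n = (if n = 1 then 1 / 4 else 0) +
      ∑ x ∈ antidiagonal n, catalanWeight x.1 * catalanWeight x.2 := by
  match n with
  | 0 => simp [catalanWeight]
  | 1 => simp [catalanWeight, Finset.Nat.antidiagonal_succ]
  | n + 2 =>
    rw [Finset.Nat.sum_antidiagonal_succ, Finset.Nat.sum_antidiagonal_succ']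
    simp only [catalanWeight, catalan_succ']
    push_cast
    rw [Finset.sum_div]
    simp only [zero_mul, mul_zero, zero_add]
    refine Finset.sum_congr rfl fun x hx => ?_
    rw [Finset.HasAntidiagonal.mem_antidiagonal] at hx
    rw [← hx]
    field_simp
    ring

/-- The partial sums satisfy `S_{N+1} ≤ 1/4 + S_N ^ 2`, which preserves the bound `1/2`. -/
theorem sum_range_catalanWeight_le (N : ℕ) : ∑ n ∈ Finset.range N, catalanWeight n ≤ 1 / 2 := by
  induction N with
  | zero => simp
  | succ N ih =>
    have hnn : 0 ≤ ∑ n ∈ Finset.range N, catalanWeight n :=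
      Finset.sum_nonneg fun _ _ => catalanWeight_nonneg _
    have h1 : ∑ n ∈ Finset.range (N + 1), (if n = 1 then (1 / 4 : ℝ) else 0) ≤ 1 / 4 := by
      rw [Finset.sum_ite_eq']
      split_ifs <;> norm_num
    have h2 : ∑ n ∈ Finset.range (N + 1), ∑ x ∈ antidiagonal n,
        catalanWeight x.1 * catalanWeight x.2 ≤ (∑ n ∈ Finset.range N, catalanWeight n) *
          ∑ n ∈ Finset.range N, catalanWeight n := by
      rw [Finset.sum_mul_sum, ← Finset.sum_product', Finset.sum_sigma']
      -- The weight at `0` vanishes; once zero indices are dropped, `c + d ≤ N` forces `c, d < N`.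
      rw [← Finset.sum_filter_of_ne
        (p := fun y : (_ : ℕ) × ℕ × ℕ => y.2.1 ≠ 0 ∧ y.2.2 ≠ 0)]
      · rw [← Finset.sum_image (f := fun x : ℕ × ℕ => catalanWeight x.1 * catalanWeight x.2)
          (g := fun y : (_ : ℕ) × ℕ × ℕ => y.2)]
        · refine Finset.sum_le_sum_of_subset_of_nonneg ?_ fun x _ _ =>
            mul_nonneg (catalanWeight_nonneg _) (catalanWeight_nonneg _)
          rintro ⟨a, b⟩ hx
          simp only [Finset.mem_image, Finset.mem_filter, Finset.mem_sigma, Finset.mem_range,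
            Finset.HasAntidiagonal.mem_antidiagonal] at hx
          obtain ⟨⟨n, c, d⟩, ⟨⟨h1, h2⟩, h3, h4⟩, h5⟩ := hx
          simp only [Prod.mk.injEq] at h1 h5 h2 h3 h4
          simp only [Finset.mem_product, Finset.mem_range]
          omega
        · rintro ⟨n, c, d⟩ h ⟨n', c', d'⟩ h' e
          simp only [Finset.coe_filter, Set.mem_ofPred_eq, Finset.mem_sigma,
            Finset.HasAntidiagonal.mem_antidiagonal] at h h' e
          obtain ⟨rfl, rfl⟩ := Prod.mk.inj e
          obtain rfl : n = n' := by omega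
          rfl
      · rintro ⟨n, c, d⟩ _ h
        constructor
        · rintro rfl
          exact h (by simp [catalanWeight])
        · rintro rfl
          exact h (by simp [catalanWeight])
    calc ∑ n ∈ Finset.range (N + 1), catalanWeight n
        = ∑ n ∈ Finset.range (N + 1), (if n = 1 then (1 / 4 : ℝ) else 0) +
          ∑ n ∈ Finset.range (N + 1), ∑ x ∈ antidiagonal n,
            catalanWeight x.1 * catalanWeight x.2 := by
          rw [← Finset.sum_add_distrib]
          exact Finset.sum_congr rfl fun n _ => catalanWeight_eq_add_conv n
      _ ≤ 1 / 2 := by nlinarith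

theorem summable_catalanWeight : Summable catalanWeight :=
  summable_of_sum_range_le catalanWeight_nonneg sum_range_catalanWeight_le

/-- The sum of the Cauchy product of summable nonnegative real sequences. -/
theorem hasSum_conv {f g : ℕ → ℝ} {F G : ℝ} (hf0 : ∀ n, 0 ≤ f n) (hg0 : ∀ n, 0 ≤ g n)
    (hf : HasSum f F) (hg : HasSum g G) :
    HasSum (fun n => ∑ x ∈ antidiagonal n, f x.1 * g x.2) (F * G) := by
  have hfn : Summable fun n => ‖f n‖ := by
    simpa only [Real.norm_of_nonneg (hf0 _)] using hf.summable
  have hgn : Summable fun n => ‖g n‖ := by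
    simpa only [Real.norm_of_nonneg (hg0 _)] using hg.summable
  rw [← hf.tsum_eq, ← hg.tsum_eq, tsum_mul_tsum_eq_tsum_sum_antidiagonal_of_summable_norm hfn hgn]
  exact (summable_norm_sum_mul_antidiagonal_of_summable_norm hfn hgn).of_norm.hasSum

theorem hasSum_catalanWeight : HasSum catalanWeight (1 / 2) := by
  obtain ⟨A, hA⟩ := summable_catalanWeight
  have h := (hasSum_ite_eq (1 : ℕ) (1 / 4 : ℝ)).add
    (hasSum_conv catalanWeight_nonneg catalanWeight_nonneg hA hA)
  have h2 : A = 1 / 4 + A * A := by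
    refine hA.unique ?_
    convert! h using 1
    funext n
    exact catalanWeight_eq_add_conv n
  -- The equation for `A` has the double root `1/2`.
  have : A = 1 / 2 := by nlinarith [sq_nonneg (A - 1 / 2)]
  rwa [← this]

/-- The sequence equals `stirlingSeq (2n) / stirlingSeq n ^ 2`. -/
theorem tendsto_centralBinom_mul_sqrt_div :
    Tendsto (fun n : ℕ => (n.centralBinom : ℝ) * √n / 4 ^ n) atTop (𝓝 (1 / √Real.pi)) := by
  have hs := Stirling.tendsto_stirlingSeq_sqrt_pi
  have hpi : √Real.pi ≠ 0 := by positivity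
  have h := (hs.comp (tendsto_id.const_mul_atTop' (r := 2) two_pos)).div (hs.pow 2)
    (pow_ne_zero 2 hpi)
  have e : √Real.pi / √Real.pi ^ 2 = 1 / √Real.pi := by field_simp
  rw [e] at h
  refine h.congr' ?_
  filter_upwards [eventually_ne_atTop 0] with n hn
  have hn' : (0 : ℝ) < n := by positivity
  have hc : (n.centralBinom : ℝ) = (2 * n).factorial / (n.factorial : ℝ) ^ 2 := by
    rw [Nat.centralBinom_eq_two_mul_choose, Nat.cast_choose ℝ (by omega)]
    rw [show 2 * n - n = n by omega, sq]
  simp only [Function.comp, id, Pi.div_apply, Stirling.stirlingSeq, hc]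
  have h4 : √(2 * ((2 * n : ℕ) : ℝ)) = 2 * √n := by
    push_cast
    rw [← mul_assoc, Real.sqrt_mul (by norm_num)]
    norm_num
  have h2 : √(2 * (n : ℝ)) ^ 2 = 2 * n := Real.sq_sqrt (by positivity)
  have h5 : (n : ℝ) = √n ^ 2 := (Real.sq_sqrt hn'.le).symm
  have hsn : √(n : ℝ) ≠ 0 := by positivity
  have h6 : (((2 * n : ℕ) : ℝ) / Real.exp 1) ^ (2 * n) =
      4 ^ n * ((n / Real.exp 1) ^ n) ^ 2 := by
    push_cast
    rw [mul_div_assoc, mul_pow, pow_mul, ← pow_mul _ n 2, mul_comm n 2]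
    norm_num
  rw [h4, h6]
  have hE : ((n : ℝ) / Real.exp 1) ^ n ≠ 0 := by positivity
  have hF : (n.factorial : ℝ) ≠ 0 := by positivity
  generalize ((n : ℝ) / Real.exp 1) ^ n = E at *
  rw [div_pow, mul_pow, h2]
  generalize √(n : ℝ) = s at *
  rw [h5]
  field_simp

theorem catalanWeight_succ_eq (n : ℕ) :
    catalanWeight (n + 1) = n.centralBinom / (4 ^ (n + 1) * (n + 1)) := by
  have h : ((n : ℝ) + 1) * catalan n = n.centralBinom := by
    exact_mod_cast succ_mul_catalan_eq_centralBinom n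
  rw [catalanWeight, ← h]
  field_simp

theorem tendsto_catalanWeight_mul_rpow :
    Tendsto (fun n : ℕ => catalanWeight n * (n : ℝ) ^ (3 / 2 : ℝ)) atTop
      (𝓝 (1 / (4 * √Real.pi))) := by
  rw [← tendsto_add_atTop_iff_nat 1]
  have h1 : Tendsto (fun n : ℕ => √(1 + 1 / (n : ℝ))) atTop (𝓝 1) := by
    have : Tendsto (fun n : ℕ => 1 + 1 / (n : ℝ)) atTop (𝓝 (1 + 0)) :=
      tendsto_const_nhds.add tendsto_one_div_atTop_nhds_zero_nat
    simpa [Function.comp_def] using (Real.continuous_sqrt.tendsto _).comp this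
  have h := (tendsto_centralBinom_mul_sqrt_div.mul h1).const_mul (1 / 4)
  have e : 1 / 4 * (1 / √Real.pi * 1) = 1 / (4 * √Real.pi) := by
    field_simp
  rw [e] at h
  refine h.congr' ?_
  filter_upwards [eventually_ne_atTop 0] with n hn
  have hn' : (0 : ℝ) < n := by positivity
  have hs : √(n : ℝ) * √(1 + 1 / (n : ℝ)) = √((n : ℝ) + 1) := by
    rw [← Real.sqrt_mul hn'.le]
    congr 1
    field_simp
  have hp : (((n + 1 : ℕ) : ℝ)) ^ (3 / 2 : ℝ) = (n + 1) * √((n : ℝ) + 1) := by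
    push_cast
    rw [Real.sqrt_eq_rpow, show (3 / 2 : ℝ) = 1 + 1 / 2 by norm_num,
      Real.rpow_add (by positivity), Real.rpow_one]
  rw [hp, catalanWeight_succ_eq, ← hs, pow_succ]
  field_simp

theorem tendsto_catalanWeight_ratio (i : ℕ) :
    Tendsto (fun n : ℕ => catalanWeight (n - i) / catalanWeight n) atTop (𝓝 1) := by
  have hbase : Tendsto (fun n : ℕ => catalanWeight n / catalanWeight (n + 1)) atTop (𝓝 1) := by
    have hc := tendsto_catalanWeight_mul_rpow
    have hc' := (tendsto_add_atTop_iff_nat 1).2 hc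
    have hpi : 1 / (4 * √Real.pi) ≠ 0 := by positivity
    have hq := hc.div hc' hpi
    rw [div_self hpi] at hq
    have h0 : Tendsto (fun n : ℕ => 1 + 1 / (n : ℝ)) atTop (𝓝 (1 + 0)) :=
      tendsto_const_nhds.add tendsto_one_div_atTop_nhds_zero_nat
    rw [add_zero] at h0
    have h1 := hq.mul (h0.rpow_const (p := 3 / 2) (Or.inl one_ne_zero))
    rw [Real.one_rpow, mul_one] at h1
    refine h1.congr' ?_
    filter_upwards [eventually_ne_atTop 0] with n hn
    have hn' : (0 : ℝ) < n := by positivity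
    have e : (1 + 1 / (n : ℝ)) = ((n + 1 : ℕ) : ℝ) / n := by
      push_cast
      field_simp
    rw [e, Real.div_rpow (by positivity) (by positivity)]
    have ha := (catalanWeight_pos (Nat.succ_ne_zero n)).ne'
    have hb : (n : ℝ) ^ (3 / 2 : ℝ) ≠ 0 := by positivity
    have hd : ((n + 1 : ℕ) : ℝ) ^ (3 / 2 : ℝ) ≠ 0 := by positivity
    simp only [Pi.div_apply]
    field_simp
  rw [← tendsto_add_atTop_iff_nat i]
  simp only [Nat.add_sub_cancel]
  induction i with
  | zero =>
    refine tendsto_const_nhds.congr' ?_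
    filter_upwards [eventually_ne_atTop 0] with n hn
    exact (div_self (catalanWeight_pos hn).ne').symm
  | succ i ih =>
    have h := ih.mul ((tendsto_add_atTop_iff_nat i).2 hbase)
    rw [mul_one] at h
    refine h.congr' ?_
    filter_upwards [eventually_ne_atTop 0] with n hn
    have := (catalanWeight_pos (n := n + i) (by omega)).ne'
    rw [div_mul_div_cancel₀ this, add_assoc]

/-! ### Convolution asymptotics relative to the Catalan weights -/

theorem conv_eq_ends_add_middle (b c : ℕ → ℝ) {n K : ℕ} (h : 2 * K ≤ n + 1) :
    ∑ x ∈ antidiagonal n, b x.1 * c x.2 =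
      ∑ i ∈ Finset.range K, b i * c (n - i) + ∑ i ∈ Finset.range K, c i * b (n - i) +
        ∑ i ∈ Finset.Ico K (n + 1 - K), b i * c (n - i) := by
  rw [Finset.Nat.sum_antidiagonal_eq_sum_range_succ (fun i j => b i * c j), Nat.succ_eq_add_one,
    Finset.range_eq_Ico, ← Finset.sum_Ico_consecutive _ (Nat.zero_le K) (by omega : K ≤ n + 1),
    ← Finset.sum_Ico_consecutive _ (by omega : K ≤ n + 1 - K) (by omega : n + 1 - K ≤ n + 1)]
  have e : ∑ i ∈ Finset.Ico (n + 1 - K) (n + 1), b i * c (n - i) =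
      ∑ i ∈ Finset.Ico 0 K, c i * b (n - i) := by
    have := Finset.sum_Ico_reflect (fun i => b i * c (n - i)) 0 (m := K) (n := n) (by omega)
    rw [Nat.sub_zero] at this
    rw [← this]
    refine Finset.sum_congr rfl fun i hi => ?_
    rw [Finset.mem_Ico] at hi
    rw [show n - (n - i) = i by omega, mul_comm]
  rw [e, ← Finset.range_eq_Ico]
  ring

/-- The middle part of the self-convolution of the Catalan weights, relative to the weights. -/
theorem tendsto_middle_div_catalanWeight (K : ℕ) :
    Tendsto (fun n => (∑ i ∈ Finset.Ico K (n + 1 - K), catalanWeight i * catalanWeight (n - i)) /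
      catalanWeight n) atTop (𝓝 (1 - 2 * ∑ i ∈ Finset.range K, catalanWeight i)) := by
  -- The middle is the full self-convolution, which is the weight itself, minus two equal ends. The
  -- limit tends to `0` as `K` grows because the weights sum to `1/2`.
  have h : Tendsto (fun n => 1 - 2 * ∑ i ∈ Finset.range K,
      catalanWeight i * (catalanWeight (n - i) / catalanWeight n)) atTop
      (𝓝 (1 - 2 * ∑ i ∈ Finset.range K, catalanWeight i * 1)) :=
    (((tendsto_finsetSum _ fun i _ =>
      (tendsto_catalanWeight_ratio i).const_mul (catalanWeight i))).const_mul 2).const_sub 1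
  simp only [mul_one] at h
  refine h.congr' ?_
  filter_upwards [eventually_ge_atTop (2 * K + 2)] with n hn
  have h1 := catalanWeight_eq_add_conv n
  rw [if_neg (by omega), zero_add, conv_eq_ends_add_middle _ _ (by omega : 2 * K ≤ n + 1)] at h1
  have hp := (catalanWeight_pos (n := n) (by omega)).ne'
  simp only [← mul_div_assoc]
  rw [← Finset.sum_div]
  field_simp
  linarith

/-- A bounded nonnegative error that is halved up to any positive amount vanishes. -/
theorem tendsto_zero_of_eventually_le_half {e : ℕ → ℝ} (M₀ : ℝ) (hM₀ : ∀ᶠ n in atTop, |e n| ≤ M₀)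
    (h : ∀ M, 0 ≤ M → (∀ᶠ n in atTop, |e n| ≤ M) → ∀ ε > 0, ∀ᶠ n in atTop, |e n| ≤ M / 2 + ε) :
    Tendsto e atTop (𝓝 0) := by
  set S : Set ℝ := {M | 0 ≤ M ∧ ∀ᶠ n in atTop, |e n| ≤ M} with hS
  have hne : S.Nonempty := ⟨max M₀ 0, le_max_right _ _, hM₀.mono fun n hn => hn.trans
    (le_max_left _ _)⟩
  have hbd : BddBelow S := ⟨0, fun x hx => hx.1⟩
  have hs0 : 0 ≤ sInf S := le_csInf hne fun x hx => hx.1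
  have key : sInf S = 0 := by
    by_contra hc
    have hpos : 0 < sInf S := lt_of_le_of_ne hs0 (Ne.symm hc)
    obtain ⟨M, hM, hlt⟩ := exists_lt_of_csInf_lt hne (show sInf S < 3 / 2 * sInf S by linarith)
    -- From `M < 3s/2`, with `s` the infimum, the new bound is below `7s/8 < s`.
    have h1 : M / 2 + sInf S / 8 ∈ S := ⟨by linarith [hM.1], h M hM.1 hM.2 _ (by positivity)⟩
    have := csInf_le hbd h1
    linarith
  rw [Metric.tendsto_nhds]
  intro ε hε
  obtain ⟨M, hM, hlt⟩ := exists_lt_of_csInf_lt hne (show sInf S < ε by rw [key]; exact hε)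
  filter_upwards [hM.2] with n hn
  rw [Real.dist_eq, sub_zero]
  exact hn.trans_lt hlt

/-! ### Passing from one threshold to the next -/

section Step

variable {r : ℝ} {u v : ℕ → ℝ}

theorem hasSum_step (hr : 0 < r) (hv0 : ∀ n, 0 ≤ v n) (hvu : ∀ n, v n ≤ u n)
    (hua : ∀ n, u n ≤ catalanWeight n)
    (hrec : ∀ n, u n - v n = (if n = 1 then r else 0) +
      ∑ x ∈ antidiagonal n, v x.1 * (u x.2 - v x.2))
    {U : ℝ} (hU : HasSum u U) : HasSum v (Psi r U) := by
  have hvs : Summable v := Summable.of_nonneg_of_le hv0 hvu hU.summable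
  obtain ⟨V, hV⟩ := hvs
  have hVU : V ≤ U := hasSum_le hvu hV hU
  have hU2 : U ≤ 1 / 2 := hasSum_le hua hU hasSum_catalanWeight
  have h1 : U - V = r + V * (U - V) := by
    refine (hU.sub hV).unique ?_
    convert! (hasSum_ite_eq (1 : ℕ) r).add
      (hasSum_conv hv0 (fun n => sub_nonneg.2 (hvu n)) hV (hU.sub hV)) using 1
    funext n
    exact hrec n
  -- The bounds `V ≤ U ≤ 1/2` make `1 + U - 2V` nonnegative, which selects the root of the
  -- quadratic.
  have hs : √((1 - U) ^ 2 + 4 * r) = 1 + U - 2 * V := by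
    rw [Real.sqrt_eq_iff_mul_self_eq (by positivity) (by linarith)]
    linarith
  have : Psi r U = V := by
    rw [Psi, hs]
    ring
  rwa [this]

/-- Since `u` and `v` are dominated by the Catalan weights, the middle of the convolution is
controlled by theirs. The ends give the linearised equation `L (1 + U - 2V) = l (1 - V)`, and the
deviation from `L` is contracted because `∑ |2v - u| ≤ U ≤ 1/2`. -/
theorem tendsto_step (hr : 0 < r) (hv0 : ∀ n, 0 ≤ v n) (hvu : ∀ n, v n ≤ u n)
    (hua : ∀ n, u n ≤ catalanWeight n)
    (hrec : ∀ n, u n - v n = (if n = 1 then r else 0) +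
      ∑ x ∈ antidiagonal n, v x.1 * (u x.2 - v x.2))
    {U l : ℝ} (hU : HasSum u U)
    (hl : Tendsto (fun n => u n / catalanWeight n) atTop (𝓝 l)) :
    Tendsto (fun n => v n / catalanWeight n) atTop
      (𝓝 (l * (1 / 2 * (1 + (1 - U) / √((1 - U) ^ 2 + 4 * r))))) := by
  have hV := hasSum_step hr hv0 hvu hua hrec hU
  have hU2 : U ≤ 1 / 2 := hasSum_le hua hU hasSum_catalanWeight
  set s := √((1 - U) ^ 2 + 4 * r) with hs
  have hspos : 0 < s := Real.sqrt_pos.2 (by positivity)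
  set L := l * (1 / 2 * (1 + (1 - U) / s)) with hL
  set V := Psi r U with hVdef
  have hVs : 1 + U - 2 * V = s := by rw [hVdef, Psi, ← hs]; ring
  have hbal : l * (1 - V) + L * ((2 * V - U) - 1) = 0 := by
    have e1 : (2 * V - U) - 1 = -s := by linarith
    have e2 : 1 - V = (1 - U + s) / 2 := by linarith
    rw [e1, e2, hL]
    field_simp
    ring
  have hu0 : ∀ n, 0 ≤ u n := fun n => (hv0 n).trans (hvu n)
  have hva : ∀ n, v n ≤ catalanWeight n := fun n => (hvu n).trans (hua n)
  set e : ℕ → ℝ := fun n => v n / catalanWeight n - L with he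
  have hve : ∀ n, v n = (L + e n) * catalanWeight n := by
    intro n
    rcases eq_or_ne n 0 with rfl | hn
    · have h0 : catalanWeight 0 = 0 := rfl
      rw [h0, mul_zero]
      exact le_antisymm (h0 ▸ hva 0) (hv0 0)
    · have := (catalanWeight_pos hn).ne'
      simp only [he]
      field_simp
      ring
  suffices h : Tendsto e atTop (𝓝 0) by
    have := h.add_const L
    simpa [he] using this
  refine tendsto_zero_of_eventually_le_half (1 + |L|) ?_ ?_
  · filter_upwards with n
    have h1 : |v n / catalanWeight n| ≤ 1 := by
      rw [abs_of_nonneg (div_nonneg (hv0 n) (catalanWeight_nonneg n))]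
      exact div_le_one_of_le₀ (hva n) (catalanWeight_nonneg n)
    exact (abs_sub _ _).trans (by linarith)
  intro M hM0 hM ε hε
  -- By `hbal`, truncating the balance at `K` leaves a vanishing defect; `K` is chosen so that this
  -- defect and the limiting middle total less than `ε`.
  have hTK : Tendsto (fun K => |l * (1 - ∑ i ∈ Finset.range K, v i) +
      L * ((2 * ∑ i ∈ Finset.range K, v i - ∑ i ∈ Finset.range K, u i) - 1)| +
      (1 - 2 * ∑ i ∈ Finset.range K, catalanWeight i)) atTop (𝓝 0) := by
    have hv' := hV.tendsto_sum_nat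
    have hu' := hU.tendsto_sum_nat
    have ha' := hasSum_catalanWeight.tendsto_sum_nat
    have := ((((hv'.const_sub 1).const_mul l).add
      ((((hv'.const_mul 2).sub hu').sub_const 1).const_mul L)).abs).add
        ((ha'.const_mul 2).const_sub 1)
    rw [hbal] at this
    simpa using this
  obtain ⟨K, hK⟩ := (hTK.eventually (gt_mem_nhds hε)).exists
  have hshift : ∀ i, Tendsto (fun n => u (n - i) / catalanWeight n) atTop (𝓝 l) := by
    intro i
    have h := (hl.comp (tendsto_sub_atTop_nat i)).mul (tendsto_catalanWeight_ratio i)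
    rw [mul_one] at h
    refine h.congr' ?_
    filter_upwards [eventually_gt_atTop i] with n hn
    exact div_mul_div_cancel₀ (catalanWeight_pos (n := n - i) (by omega)).ne'
  -- `T` is the part of the normalised recurrence left when every error `e` is replaced by `0` and
  -- the middle is omitted.
  set T : ℕ → ℝ := fun n => u n / catalanWeight n -
    ∑ i ∈ Finset.range K, v i * (u (n - i) / catalanWeight n) +
    L * (∑ i ∈ Finset.range K, (2 * v i - u i) * (catalanWeight (n - i) / catalanWeight n) - 1)
    with hT
  have hTlim : Tendsto T atTop (𝓝 (l * (1 - ∑ i ∈ Finset.range K, v i) +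
      L * ((2 * ∑ i ∈ Finset.range K, v i - ∑ i ∈ Finset.range K, u i) - 1))) := by
    have h1 : Tendsto (fun n => ∑ i ∈ Finset.range K, v i * (u (n - i) / catalanWeight n)) atTop
        (𝓝 (∑ i ∈ Finset.range K, v i * l)) :=
      tendsto_finsetSum _ fun i _ => (hshift i).const_mul (v i)
    have h2 : Tendsto (fun n => ∑ i ∈ Finset.range K,
        (2 * v i - u i) * (catalanWeight (n - i) / catalanWeight n)) atTop
        (𝓝 (∑ i ∈ Finset.range K, (2 * v i - u i) * 1)) :=
      tendsto_finsetSum _ fun i _ => (tendsto_catalanWeight_ratio i).const_mul _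
    have := (hl.sub h1).add ((h2.sub_const 1).const_mul L)
    convert this using 2
    rw [← Finset.sum_mul]
    simp only [mul_one, Finset.sum_sub_distrib, ← Finset.mul_sum]
    ring
  have hQlim : Tendsto (fun n => ∑ i ∈ Finset.range K,
      u i * (catalanWeight (n - i) / catalanWeight n)) atTop
      (𝓝 (∑ i ∈ Finset.range K, u i * 1)) :=
    tendsto_finsetSum _ fun i _ => (tendsto_catalanWeight_ratio i).const_mul _
  simp only [mul_one] at hQlim
  have hQ : ∑ i ∈ Finset.range K, u i ≤ 1 / 2 :=
    (sum_le_hasSum _ (fun i _ => hu0 i) hU).trans hU2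
  have hR := (hTlim.abs.add (hQlim.const_mul M)).add (tendsto_middle_div_catalanWeight K)
  have hRlt : |l * (1 - ∑ i ∈ Finset.range K, v i) +
      L * ((2 * ∑ i ∈ Finset.range K, v i - ∑ i ∈ Finset.range K, u i) - 1)| +
      M * ∑ i ∈ Finset.range K, u i + (1 - 2 * ∑ i ∈ Finset.range K, catalanWeight i) <
      M / 2 + ε := by
    have := mul_le_mul_of_nonneg_left hQ hM0
    linarith
  have hMs : ∀ᶠ n in atTop, ∀ j, n ≤ j + K → |e j| ≤ M := by
    obtain ⟨N, hN⟩ := eventually_atTop.1 hM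
    filter_upwards [eventually_ge_atTop (N + K)] with n hn j hj
    exact hN j (by omega)
  filter_upwards [hR.eventually (gt_mem_nhds hRlt), hMs, eventually_ge_atTop (2 * K + 2)]
    with n hn hMn hnK
  refine le_trans ?_ hn.le
  have hap : 0 < catalanWeight n := catalanWeight_pos (by omega)
  set mid := ∑ i ∈ Finset.Ico K (n + 1 - K), v i * (u (n - i) - v (n - i)) with hmid
  have hmid0 : 0 ≤ mid := Finset.sum_nonneg fun i _ => mul_nonneg (hv0 _) (sub_nonneg.2 (hvu _))
  have hmid1 : mid ≤ ∑ i ∈ Finset.Ico K (n + 1 - K), catalanWeight i * catalanWeight (n - i) :=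
    Finset.sum_le_sum fun i _ => mul_le_mul (hva _) (by linarith [hv0 (n - i), hua (n - i)])
      (sub_nonneg.2 (hvu _)) (catalanWeight_nonneg _)
  -- Substitute `v (n - i) = (L + e (n - i)) a (n - i)` in both ends: only the last `K` errors
  -- enter, with coefficients `2 v i - u i`.
  have hkey : e n = T n + ∑ i ∈ Finset.range K,
      (2 * v i - u i) * (e (n - i) * (catalanWeight (n - i) / catalanWeight n)) -
      mid / catalanWeight n := by
    have h1 := hrec n
    rw [if_neg (by omega), zero_add,
      conv_eq_ends_add_middle v (fun j => u j - v j) (by omega : 2 * K ≤ n + 1), ← hmid] at h1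
    have h2 : ∑ i ∈ Finset.range K, v i * (u (n - i) - v (n - i)) +
        ∑ i ∈ Finset.range K, (u i - v i) * v (n - i) =
        ∑ i ∈ Finset.range K, v i * u (n - i) -
        (L * ∑ i ∈ Finset.range K, (2 * v i - u i) * catalanWeight (n - i) +
        ∑ i ∈ Finset.range K, (2 * v i - u i) * (e (n - i) * catalanWeight (n - i))) := by
      rw [Finset.mul_sum, ← Finset.sum_add_distrib, ← Finset.sum_add_distrib,
        ← Finset.sum_sub_distrib]
      refine Finset.sum_congr rfl fun i _ => ?_
      rw [hve (n - i)]
      ring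
    rw [h2] at h1
    simp only [← mul_assoc] at h1
    have hen : e n = v n / catalanWeight n - L := rfl
    rw [hen, hT]
    simp only [← mul_div_assoc, ← Finset.sum_div]
    field_simp
    linarith
  have hsum : |∑ i ∈ Finset.range K,
      (2 * v i - u i) * (e (n - i) * (catalanWeight (n - i) / catalanWeight n))| ≤
      M * ∑ i ∈ Finset.range K, u i * (catalanWeight (n - i) / catalanWeight n) := by
    rw [Finset.mul_sum]
    refine (Finset.abs_sum_le_sum_abs _ _).trans (Finset.sum_le_sum fun i hi => ?_)
    rw [Finset.mem_range] at hi
    have hq : 0 ≤ catalanWeight (n - i) / catalanWeight n :=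
      div_nonneg (catalanWeight_nonneg _) hap.le
    have ha : |2 * v i - u i| ≤ u i := abs_le.2 ⟨by linarith [hv0 i], by linarith [hvu i]⟩
    rw [abs_mul, abs_mul, abs_of_nonneg hq]
    calc |2 * v i - u i| * (|e (n - i)| * (catalanWeight (n - i) / catalanWeight n))
        ≤ u i * (M * (catalanWeight (n - i) / catalanWeight n)) := by
          refine mul_le_mul ha ?_ (by positivity) (hu0 i)
          exact mul_le_mul_of_nonneg_right (hMn _ (by omega)) hq
      _ = _ := by ring
  have hm1 : |mid / catalanWeight n| ≤ (∑ i ∈ Finset.Ico K (n + 1 - K),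
      catalanWeight i * catalanWeight (n - i)) / catalanWeight n := by
    rw [abs_of_nonneg (div_nonneg hmid0 hap.le)]
    gcongr
  rw [hkey]
  exact (abs_sub _ _).trans (add_le_add ((abs_add_le _ _).trans (by gcongr)) hm1)

end Step

theorem hasDerivAt_Psi {r : ℝ} (hr : 0 < r) (v : ℝ) :
    HasDerivAt (fun v : ℝ => Psi r v)
      (1 / 2 * (1 + (1 - v) / √((1 - v) ^ 2 + 4 * r))) v := by
  have hpos : 0 < (1 - v) ^ 2 + 4 * r := by positivity
  have h1 : HasDerivAt (fun v : ℝ => (1 - v) ^ 2 + 4 * r) (2 * (1 - v) * (-1)) v := by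
    simpa using (((hasDerivAt_id v).const_sub 1).pow 2).add_const (4 * r)
  have h := (((hasDerivAt_id v).const_add 1).sub (h1.sqrt hpos.ne')).div_const 2
  have hs : √((1 - v) ^ 2 + 4 * r) ≠ 0 := (Real.sqrt_pos.2 hpos).ne'
  refine h.congr_deriv ?_
  field_simp
  ring

/-! ### Iteration along the chain -/

/-- The limiting ratio at level `k` of the chain. -/
noncomputable def critProd (r : ℝ) (k : ℕ) : ℝ :=
  ∏ i ∈ Finset.range k,
    (1 / 2 : ℝ) * (1 + (1 - critIter r i) / √((1 - critIter r i) ^ 2 + 4 * r))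

/-- The upper counts normalised by the exponential growth rate. -/
noncomputable def upperWeight (m k n : ℕ) : ℝ :=
  upperCount m k n * (1 / (4 * (m : ℝ))) ^ n

variable {m : ℕ}

theorem upperWeight_zero (hm : m ≠ 0) (n : ℕ) : upperWeight m 0 n = catalanWeight n := by
  have : (m : ℝ) ≠ 0 := by exact_mod_cast hm
  match n with
  | 0 => simp [upperWeight, upperCount_zero_zero, catalanWeight]
  | n + 1 =>
    rw [upperWeight, upperCount_zero_succ, catalanWeight]
    push_cast
    rw [div_pow, one_pow, mul_pow]
    field_simp

theorem upperWeight_nonneg (k n : ℕ) : 0 ≤ upperWeight m k n := by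
  unfold upperWeight
  positivity

theorem upperWeight_sub {k : ℕ} (hk : k < m) (n : ℕ) :
    upperWeight m k n - upperWeight m (k + 1) n =
      count m n ⟨k, hk⟩ * (1 / (4 * (m : ℝ))) ^ n := by
  have h := upperCount_eq_add m n ⟨k, hk⟩
  simp only at h
  rw [upperWeight, upperWeight, h]
  push_cast
  ring

theorem upperWeight_succ_le {k : ℕ} (hk : k < m) (n : ℕ) :
    upperWeight m (k + 1) n ≤ upperWeight m k n := by
  rw [← sub_nonneg, upperWeight_sub hk]
  positivity

theorem upperWeight_recurrence {k : ℕ} (hk : k + 1 < m) (n : ℕ) :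
    upperWeight m k n - upperWeight m (k + 1) n = (if n = 1 then 1 / (4 * (m : ℝ)) else 0) +
      ∑ x ∈ antidiagonal n, upperWeight m (k + 1) x.1 *
        (upperWeight m k x.2 - upperWeight m (k + 1) x.2) := by
  simp only [upperWeight_sub (Nat.lt_of_succ_lt hk)]
  rw [count_recurrence m n ⟨k, Nat.lt_of_succ_lt hk⟩ hk]
  push_cast
  rw [add_mul, Finset.sum_mul]
  congr 1
  · split_ifs with h
    · rw [h, pow_one, one_mul]
    · rw [zero_mul]
  · refine Finset.sum_congr rfl fun x hx => ?_
    rw [Finset.HasAntidiagonal.mem_antidiagonal] at hx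
    rw [upperWeight, ← hx, pow_add]
    ring

theorem upperWeight_le_catalanWeight {k : ℕ} (hk : k < m) (n : ℕ) :
    upperWeight m k n ≤ catalanWeight n := by
  induction k with
  | zero => exact (upperWeight_zero (by omega) n).le
  | succ k ih => exact (upperWeight_succ_le (by omega) n).trans (ih (by omega))

theorem upperWeight_asymptotics {k : ℕ} (hk : k < m) :
    HasSum (upperWeight m k) (critIter (1 / (4 * (m : ℝ))) k) ∧
    Tendsto (fun n => upperWeight m k n / catalanWeight n) atTop
      (𝓝 (critProd (1 / (4 * (m : ℝ))) k)) := by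
  have hm : (0 : ℝ) < m := by exact_mod_cast (Nat.zero_lt_of_lt hk)
  have hr : 0 < 1 / (4 * (m : ℝ)) := by positivity
  induction k with
  | zero =>
    have e : upperWeight m 0 = catalanWeight := funext (upperWeight_zero (by omega))
    rw [e]
    refine ⟨hasSum_catalanWeight, ?_⟩
    simp only [critProd, Finset.range_zero, Finset.prod_empty]
    refine tendsto_const_nhds.congr' ?_
    filter_upwards [eventually_ne_atTop 0] with n hn
    exact (div_self (catalanWeight_pos hn).ne').symm
  | succ k ih =>
    obtain ⟨h1, h2⟩ := ih (by omega)
    refine ⟨hasSum_step hr (upperWeight_nonneg _) (upperWeight_succ_le (by omega))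
      (upperWeight_le_catalanWeight (by omega)) (upperWeight_recurrence hk) h1, ?_⟩
    rw [critProd, Finset.prod_range_succ, ← critProd]
    exact tendsto_step hr (upperWeight_nonneg _) (upperWeight_succ_le (by omega))
      (upperWeight_le_catalanWeight (by omega)) (upperWeight_recurrence hk) h1 h2

theorem critIter_le_half {k : ℕ} (hk : k < m) : critIter (1 / (4 * (m : ℝ))) k ≤ 1 / 2 :=
  hasSum_le (upperWeight_le_catalanWeight hk) (upperWeight_asymptotics hk).1 hasSum_catalanWeight

/-- The iterates are sums of sequences below the Catalan weights, hence at most `1/2`, so every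
factor is positive. -/
theorem critProd_pos {k : ℕ} (hk : k ≤ m) : 0 < critProd (1 / (4 * (m : ℝ))) k := by
  refine Finset.prod_pos fun i hi => ?_
  have := critIter_le_half (m := m) (k := i) (by rw [Finset.mem_range] at hi; omega)
  have : 0 ≤ 1 - critIter (1 / (4 * (m : ℝ))) i := by linarith
  positivity

theorem upperCount_zero_isEquivalent (hm : m ≠ 0) :
    IsEquivalent atTop (fun n : ℕ => (upperCount m 0 n : ℝ))
      (fun n : ℕ => 1 / 4 * ((4 * (m : ℝ)) ^ n / (√Real.pi * (n : ℝ) ^ (3 / 2 : ℝ)))) := by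
  have hm' : (m : ℝ) ≠ 0 := by exact_mod_cast hm
  apply isEquivalent_of_tendsto_one
  have hpi : √Real.pi ≠ 0 := by positivity
  have h := tendsto_catalanWeight_mul_rpow.const_mul (4 * √Real.pi)
  rw [mul_one_div_cancel (by positivity)] at h
  refine h.congr' ?_
  filter_upwards [eventually_ne_atTop 0] with n hn
  have hn' : (n : ℝ) ^ (3 / 2 : ℝ) ≠ 0 := by positivity
  rw [← upperWeight_zero hm, upperWeight, div_pow, one_pow, Pi.div_apply]
  field_simp

end Godel

theorem mainTheorem1 (m : ℕ) (hm : 2 ≤ m) (r : ℝ) (hr : r = 1 / (4 * (m : ℝ))) :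
    Differentiable ℝ (fun v : ℝ => Godel.Psi r v) ∧
    ∃ p : ℝ,
      Tendsto (fun n : ℕ => (Godel.count m n ⟨m - 1, by omega⟩ : ℝ) / (Godel.total m n : ℝ))
        atTop (𝓝 p) ∧
      p = ∏ k ∈ Finset.range (m - 1),
        deriv (fun v : ℝ => Godel.Psi r v) (Godel.critIter r k) ∧
      p = ∏ k ∈ Finset.range (m - 1),
        (1 / 2 : ℝ) * (1 + (1 - Godel.critIter r k) /
          Real.sqrt ((1 - Godel.critIter r k) ^ 2 + 1 / (m : ℝ))) ∧
      IsEquivalent atTop (fun n : ℕ => (Godel.count m n ⟨m - 1, by omega⟩ : ℝ))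
        (fun n : ℕ => p / 4 *
          ((4 * (m : ℝ)) ^ n / (Real.sqrt Real.pi * (n : ℝ) ^ (3 / 2 : ℝ)))) := by
  have hm0 : (0 : ℝ) < m := by positivity
  have hr0 : 0 < r := by rw [hr]; positivity
  have h4r : 4 * r = 1 / (m : ℝ) := by rw [hr]; field_simp
  have hlim : Tendsto (fun n : ℕ => (Godel.count m n ⟨m - 1, by omega⟩ : ℝ) /
      (Godel.total m n : ℝ)) atTop (𝓝 (Godel.critProd r (m - 1))) := by
    have h := (Godel.upperWeight_asymptotics (m := m) (k := m - 1) (by omega)).2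
    rw [← hr] at h
    refine h.congr fun n => ?_
    rw [← Godel.upperWeight_zero (m := m) (by omega), Godel.upperWeight, Godel.upperWeight,
      mul_div_mul_right _ _ (by positivity), Godel.upperCount_last m n (by omega),
      Godel.total_eq_upperCount_zero]
  have hp : 0 < Godel.critProd r (m - 1) := by
    rw [hr]
    exact Godel.critProd_pos (by omega)
  refine ⟨fun v => (Godel.hasDerivAt_Psi hr0 v).differentiableAt, Godel.critProd r (m - 1), hlim,
    ?_, ?_, ?_⟩
  · exact Finset.prod_congr rfl fun k _ => (Godel.hasDerivAt_Psi hr0 _).deriv.symm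
  · rw [Godel.critProd, h4r]
  -- A nonzero limit makes the ratio equivalent to a constant; multiply by the asymptotics of the
  -- total, which is nonzero except at `n = 0`.
  · have h := ((isEquivalent_const_iff_tendsto hp.ne').2 hlim).mul
      (Godel.upperCount_zero_isEquivalent (m := m) (by omega))
    refine (h.congr_left ?_).congr_right ?_
    · filter_upwards [eventually_ne_atTop 0] with n hn
      obtain ⟨n, rfl⟩ := Nat.exists_eq_succ_of_ne_zero hn
      have hne : (Godel.upperCount m 0 (n + 1) : ℝ) ≠ 0 := by
        rw [Godel.upperCount_zero_succ]
        have := Godel.catalan_pos n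
        positivity
      simp only [Pi.mul_apply, Godel.total_eq_upperCount_zero]
      exact div_mul_cancel₀ _ hne
    · filter_upwards with n
      simp only [Pi.mul_apply, Function.const_apply]
      ring
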